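/- Let $D\subset\mathbb R^2$ be an open set containing $(0,0)$ and let $\psi:D\to\mathbb R^3$ be a smooth pseudospherical surface ($K=-1$) in Chebyshev asymptotic-line coordinates $(x,y)$ with smooth angle $\varphi:D\to(0,\pi)$ between the asymptotic lines, i.e. with fundamental forms $\mathrm I=dx^2+2\cos\varphi\,dx\,dy+dy^2$ and $\mathrm{II}=2\sin\varphi\,dx\,dy$. Let $\mathcal U=\mathcal U(x,y,\lambda)\in \mathrm{SO}(3)$, $(x,y)\in D$, $\lambda>0$, be its extended normalized frame, i.e. the solution of $$\mathcal U^{-1}\partial_x\mathcal U=\begin{pmatrix}0&-\varphi_x&0\\ \varphi_x&0&\lambda\\ 0&-\lambda&0\end{pmatrix},\qquad \mathcal U^{-1}\partial_y\mathcal U=\frac1\lambda\begin{pmatrix}0&0&-\sin\varphi\\ 0&0&-\cos\varphi\\ \sin\varphi&\cos\varphi&0\end{pmatrix},\qquad \mathcal U(0,0,\lambda)=I .$$ Let $P=\mathrm{diag}(1,1,-1)$ and let $K\subset \mathrm{SO}(3)$ be the group of rotations about $e_3$. A twisted loop is a map $g:\mathbb R_{>0}\to \mathrm{SO}(3)$ with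 an analytic extension to $\mathbb C\setminus\{0\}$, $g(\lambda)=\sum_{k\in\mathbb Z}\lambda^k g_k$, such that $g(-\lambda)=P\,g(\lambda)P^{-1}$. Let $\Lambda^+$ (resp. $\Lambda^-$) be the group of twisted loops with $g_k=0$ for $k<0$ (resp. $k>0$) and $g_0\in K$, and let $\Lambda^\pm_*\subset\Lambda^\pm$ be given by $g_0=I$. Let $S_1\subset D$ (resp. $S_2\subset D$) be the set of points at which $\mathcal U$ does not lie in $\Lambda^-_*\cdot\Lambda^+$ (resp. $\Lambda^+_*\cdot\Lambda^-$), and consider the Birkhoff splittings $$\mathcal U=\mathcal U_+V_-\ \text{ on } D\setminus S_2,\qquad \mathcal U=\mathcal U_-V_+\ \text{ on } D\setminus S_1,$$ with $\mathcal U_\pm\in\Lambda^\pm_*$ and $V_\pm\in\Lambda^\pm$. Put $$\beta_1=\begin{pmatrix}0&0&0\\0&0&-1\\0&1&0\end{pmatrix}dx,\qquad \gamma_1=\begin{pmatrix}0&0&\sin\varphi(0,y)\\0&0&\cos\varphi(0,y)\\-\sin\varphi(0,y)&-\cos\varphi(0,y)&0\end{pmatrix}dy .$$ Then $\mathcal U_+$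 does not depend on $y$ and $\mathcal U_-$ does not depend on $x$, in the sense that $\mathcal U_+$ (resp. $\mathcal U_-$) takes the same value at any two points of $D\setminus S_2$ (resp. $D\setminus S_1$) joined by a vertical (resp. horizontal) segment in $D$. Moreover there are functions $V_0(x)$ and $W_0(y)$ with values in $\mathrm{SO}(3)$ such that: 1. At every $(x,y)\in D\setminus S_2$ for which the segments from $(0,0)$ to $(x,0)$ and from $(x,0)$ to $(x,y)$ lie in $D$, and for every $\lambda>0$, $\mathcal U_+$ is differentiable in $x$, $$\mathcal U_+^{-1}\,\partial_x\mathcal U_+\,dx=-\lambda\,V_0\,\beta_1V_0^{-1},$$ and $\mathcal U_+=I$ at such points with $x=0$. 2. At every $(x,y)\in D\setminus S_1$ for which the segments from $(0,0)$ to $(0,y)$ and from $(0,y)$ to $(x,y)$ lie in $D$, and for every $\lambda>0$, $\mathcal U_-$ is differentiable in $y$, $$\mathcal U_-^{-1}\,\partial_y\mathcal U_-\,dy=-\lambda^{-1}\,W_0\,\gamma_1W_0^{-1},$$ and $\mathcal U_-=I$ at such points with $y=0$. Here $V_0(x)$ is the constant term of $V_-(x,0,\lambda)=V_0+\lambda^{-1}(\cdots)$,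 and $W_0(y)$ is the constant term of $V_+(0,y,\lambda)=W_0+\lambda(\cdots)$, at the points $(x,0)$ and $(0,y)$ of the kinds in 1 and 2. -/

import Mathlib

open Set Filter Topology
open scoped ContDiff

noncomputable section

namespace Pseudospherical

/-- Real `3 × 3` matrices. -/
abbrev M3 : Type := Matrix (Fin 3) (Fin 3) ℝ

/-- Euclidean three-space. -/
abbrev E3 : Type := EuclideanSpace ℝ (Fin 3)

/-- The set of matrices forming `SO(3)`. -/
abbrev SO3 : Set M3 := {g | g ∈ Matrix.specialOrthogonalGroup (Fin 3) ℝ}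

/-- The partial derivative `∂f/∂x`. -/
def dX {E : Type*} [NormedAddCommGroup E] [NormedSpace ℝ E] (f : ℝ × ℝ → E) (p : ℝ × ℝ) : E :=
  deriv (fun t : ℝ => f (t, p.2)) p.1

/-- The partial derivative `∂f/∂y`. -/
def dY {E : Type*} [NormedAddCommGroup E] [NormedSpace ℝ E] (f : ℝ × ℝ → E) (p : ℝ × ℝ) : E :=
  deriv (fun t : ℝ => f (p.1, t)) p.2

/-- `ψ : D → ℝ³` is a pseudospherical surface (`K = -1`), parametrized by asymptotic lines in arc
length (a Chebyshev net), and `φ` is the angle between the asymptotic lines: the fundamental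
forms are `I = dx² + 2 cos φ dx dy + dy²` and `II = 2 sin φ dx dy`, the latter with respect to the
unit normal `N`. -/
structure IsChebyshevSurface (D : Set (ℝ × ℝ)) (ψ N : ℝ × ℝ → E3) (φ : ℝ × ℝ → ℝ) : Prop where
  smooth : ContDiffOn ℝ ∞ ψ D
  smooth_angle : ContDiffOn ℝ ∞ φ D
  angle_mem : ∀ p ∈ D, φ p ∈ Ioo 0 Real.pi
  norm_dX : ∀ p ∈ D, ‖dX ψ p‖ = 1
  norm_dY : ∀ p ∈ D, ‖dY ψ p‖ = 1
  inner_dX_dY : ∀ p ∈ D, inner ℝ (dX ψ p) (dY ψ p) = Real.cos (φ p)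
  norm_normal : ∀ p ∈ D, ‖N p‖ = 1
  normal_dX : ∀ p ∈ D, inner ℝ (N p) (dX ψ p) = 0
  normal_dY : ∀ p ∈ D, inner ℝ (N p) (dY ψ p) = 0
  second_xx : ∀ p ∈ D, inner ℝ (N p) (dX (dX ψ) p) = 0
  second_xy : ∀ p ∈ D, inner ℝ (N p) (dX (dY ψ) p) = Real.sin (φ p)
  second_yy : ∀ p ∈ D, inner ℝ (N p) (dY (dY ψ) p) = 0

/-- The `dx`-coefficient `𝒜` of the form `(𝒰^l)⁻¹ d𝒰^l`. -/
def laxA (φ : ℝ × ℝ → ℝ) (p : ℝ × ℝ) (l : ℝ) : M3 :=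
  !![0, -dX φ p, 0;
     dX φ p, 0, l;
     0, -l, 0]

/-- The `dy`-coefficient `ℬ` of the form `(𝒰^l)⁻¹ d𝒰^l`. -/
def laxB (φ : ℝ × ℝ → ℝ) (p : ℝ × ℝ) (l : ℝ) : M3 :=
  !![0, 0, -(l⁻¹ * Real.sin (φ p));
     0, 0, -(l⁻¹ * Real.cos (φ p));
     l⁻¹ * Real.sin (φ p), l⁻¹ * Real.cos (φ p), 0]

/-- `U p l`, `p ∈ D`, `l > 0`, is the extended normalized frame of the surface with asymptotic
angle `φ`: the `SO(3)`-valued solution of the Lax system that is `I` at the origin. -/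
structure IsExtendedFrame (D : Set (ℝ × ℝ)) (φ : ℝ × ℝ → ℝ) (U : ℝ × ℝ → ℝ → M3) : Prop where
  mem_SO3 : ∀ p ∈ D, ∀ l : ℝ, 0 < l → U p l ∈ SO3
  lax_x : ∀ p ∈ D, ∀ l : ℝ, 0 < l →
    HasDerivAt (fun t : ℝ => U (t, p.2) l) (U p l * laxA φ p l) p.1
  lax_y : ∀ p ∈ D, ∀ l : ℝ, 0 < l →
    HasDerivAt (fun t : ℝ => U (p.1, t) l) (U p l * laxB φ p l) p.2
  initial : ∀ l : ℝ, 0 < l → U (0, 0) l = 1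

/-- The `dx`-coefficient of `α₁`, where `-(𝒰^l)⁻¹ d𝒰^l = l⁻¹ α₋₁ + α₀ + l α₁`. -/
def alphaOne (_p : ℝ × ℝ) : M3 :=
  !![0, 0, 0;
     0, 0, -1;
     0, 1, 0]

/-- The `dy`-coefficient of `α₋₁`. -/
def alphaNegOne (φ : ℝ × ℝ → ℝ) (p : ℝ × ℝ) : M3 :=
  !![0, 0, Real.sin (φ p);
     0, 0, Real.cos (φ p);
     -Real.sin (φ p), -Real.cos (φ p), 0]

/-- The coefficient of `β₁`, the `x`-part of `α₁`. -/
def betaOne (x : ℝ) : M3 := alphaOne (x, 0)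

/-- The coefficient of `γ₁`, the `y`-part of `α₋₁`. -/
def gammaOne (φ : ℝ × ℝ → ℝ) (y : ℝ) : M3 := alphaNegOne φ (0, y)

/-- `P = diag(1, 1, -1)`. -/
def twistP : M3 := Matrix.diagonal ![1, 1, -1]

/-- The group `K` of rotations about `e₃`. -/
def rotK : Set M3 :=
  {g | ∃ r : ℝ, g = !![Real.cos r, -Real.sin r, 0; Real.sin r, Real.cos r, 0; 0, 0, 1]}

/-- `g : ℝ₊ → SO(3)` is a twisted loop with Laurent expansion `g(l) = ∑ₖ lᵏ aₖ`.
Convergence (hence absolute convergence) for every `l > 0` means that `∑ₖ zᵏ aₖ` is an analytic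
extension of `g` to `ℂ ∖ {0}`; the condition `g(-l) = P g(l) P⁻¹` on this extension is expressed
through the coefficients. -/
structure IsTwistedLoop (g : ℝ → M3) (a : ℤ → M3) : Prop where
  mem_SO3 : ∀ l : ℝ, 0 < l → g l ∈ SO3
  hasSum : ∀ l : ℝ, 0 < l → HasSum (fun k : ℤ => l ^ k • a k) (g l)
  twisted : ∀ k : ℤ, twistP * a k * twistP⁻¹ = (-1 : ℝ) ^ k • a k

/-- The connected group of twisted loops with non-negative powers of `l` only; connectedness is
the condition that the constant term lies in `K`. -/
def LoopPlus : Set (ℝ → M3) :=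
  {g | ∃ a : ℤ → M3, IsTwistedLoop g a ∧ (∀ k < 0, a k = 0) ∧ a 0 ∈ rotK}

/-- The connected group of twisted loops with non-positive powers of `l` only. -/
def LoopMinus : Set (ℝ → M3) :=
  {g | ∃ a : ℤ → M3, IsTwistedLoop g a ∧ (∀ k > 0, a k = 0) ∧ a 0 ∈ rotK}

/-- Twisted loops of the form `I + l a₁ + l² a₂ + ⋯`. -/
def LoopPlusStar : Set (ℝ → M3) :=
  {g | ∃ a : ℤ → M3, IsTwistedLoop g a ∧ (∀ k < 0, a k = 0) ∧ a 0 = 1}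

/-- Twisted loops of the form `I + l⁻¹ a₋₁ + l⁻² a₋₂ + ⋯`. -/
def LoopMinusStar : Set (ℝ → M3) :=
  {g | ∃ a : ℤ → M3, IsTwistedLoop g a ∧ (∀ k > 0, a k = 0) ∧ a 0 = 1}

/-- The Birkhoff splitting `g = g₋ g₊`. -/
def SplitMinusPlus (g gm gp : ℝ → M3) : Prop :=
  gm ∈ LoopMinusStar ∧ gp ∈ LoopPlus ∧ ∀ l : ℝ, 0 < l → g l = gm l * gp l

/-- The Birkhoff splitting `g = g₊ g₋`. -/
def SplitPlusMinus (g gp gm : ℝ → M3) : Prop :=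
  gp ∈ LoopPlusStar ∧ gm ∈ LoopMinus ∧ ∀ l : ℝ, 0 < l → g l = gp l * gm l

/-- The singular set `S₁` of points where `U` has no splitting `U₋ V₊`. -/
def singularOne (D : Set (ℝ × ℝ)) (U : ℝ × ℝ → ℝ → M3) : Set (ℝ × ℝ) :=
  {p ∈ D | ¬ ∃ gm gp, SplitMinusPlus (U p) gm gp}

/-- The singular set `S₂` of points where `U` has no splitting `U₊ V₋`. -/
def singularTwo (D : Set (ℝ × ℝ)) (U : ℝ × ℝ → ℝ → M3) : Set (ℝ × ℝ) :=
  {p ∈ D | ¬ ∃ gp gm, SplitPlusMinus (U p) gp gm}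

/-- The points `(x, y)` over which the `x`-part is available: the path that runs straight from
`(0, 0)` to `(x, 0)` and then straight to `(x, y)` lies in `D`. If `D` meets every line parallel
to a coordinate axis in an interval, these are the points `(x, y) ∈ D` with `(x, 0) ∈ D`. -/
def xReach (D : Set (ℝ × ℝ)) : Set (ℝ × ℝ) :=
  {p | (∀ t ∈ uIcc 0 p.1, (t, 0) ∈ D) ∧ ∀ t ∈ uIcc 0 p.2, (p.1, t) ∈ D}

/-- The analogue of `xReach` with the two coordinates exchanged. -/
def yReach (D : Set (ℝ × ℝ)) : Set (ℝ × ℝ) :=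
  {p | (∀ t ∈ uIcc 0 p.2, (0, t) ∈ D) ∧ ∀ t ∈ uIcc 0 p.1, (t, p.2) ∈ D}

end Pseudospherical

end

namespace Pseudospherical

section Picard

variable {𝔸 : Type*} [NormedRing 𝔸] [NormedAlgebra ℝ 𝔸]

/-- The iterated integrals of `M`: the coefficients of the solution of `F' = z F M`, `F 0 = 1`,
as a power series in `z`. -/
noncomputable def picardCoeff (M : ℝ → 𝔸) : ℕ → ℝ → 𝔸
  | 0 => fun _ => 1
  | k + 1 => fun t => ∫ s in (0 : ℝ)..t, picardCoeff M k s * M s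

lemma continuous_picardCoeff {M : ℝ → 𝔸} (hM : Continuous M) (k : ℕ) :
    Continuous (picardCoeff M k) := by
  induction k with
  | zero => exact continuous_const
  | succ k ih =>
    exact intervalIntegral.continuous_primitive
      (fun a b => (ih.mul hM).intervalIntegrable a b) 0

lemma hasDerivAt_picardCoeff_succ [CompleteSpace 𝔸] {M : ℝ → 𝔸} (hM : Continuous M) (k : ℕ)
    (t : ℝ) : HasDerivAt (picardCoeff M (k + 1)) (picardCoeff M k t * M t) t :=
  ((continuous_picardCoeff hM k).mul hM).integral_hasStrictDerivAt 0 t |>.hasDerivAt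

lemma conj_picardCoeff [CompleteSpace 𝔸] {M : ℝ → 𝔸} (hM : Continuous M) {p : 𝔸} (hp : p * p = 1)
    (hpM : ∀ s, p * M s * p = -M s) (k : ℕ) (t : ℝ) :
    p * picardCoeff M k t * p = (-1 : ℝ) ^ k • picardCoeff M k t := by
  induction k generalizing t with
  | zero => simp [picardCoeff, hp]
  | succ k ih =>
    have hc : IntervalIntegrable (fun s => picardCoeff M k s * M s) MeasureTheory.volume 0 t :=
      ((continuous_picardCoeff hM k).mul hM).intervalIntegrable 0 t
    let L : 𝔸 →L[ℝ] 𝔸 := ContinuousLinearMap.mulLeftRight ℝ 𝔸 p p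
    have hL : ∀ u, L u = p * u * p := fun u => by simp [L]
    change p * (∫ s in (0 : ℝ)..t, picardCoeff M k s * M s) * p = (-1 : ℝ) ^ (k + 1) •
      ∫ s in (0 : ℝ)..t, picardCoeff M k s * M s
    rw [← hL, ← L.intervalIntegral_comp_comm hc, ← intervalIntegral.integral_smul]
    refine intervalIntegral.integral_congr fun s _ => ?_
    have : p * (picardCoeff M k s * M s) * p =
        (p * picardCoeff M k s * p) * (p * M s * p) := by
      calc p * (picardCoeff M k s * M s) * p
          = p * picardCoeff M k s * 1 * M s * p := by noncomm_ring
        _ = _ := by rw [← hp]; noncomm_ring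
    simp only [hL, this, ih, hpM]
    simp [pow_succ]

lemma norm_sub_sum_picardCoeff_le [CompleteSpace 𝔸] {M F : ℝ → 𝔸} (hM : Continuous M) {z B C : ℝ}
    (hz : 0 ≤ z) (hF0 : F 0 = 1)
    (hF : ∀ s ∈ Icc (0 : ℝ) 1, HasDerivAt F (z • (F s * M s)) s)
    (hB : ∀ s ∈ Icc (0 : ℝ) 1, ‖F s‖ ≤ B) (hC : ∀ s ∈ Icc (0 : ℝ) 1, ‖M s‖ ≤ C) (n : ℕ) :
    ∀ s ∈ Icc (0 : ℝ) 1, ‖F s - ∑ k ∈ Finset.range n, z ^ k • picardCoeff M k s‖ ≤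
      B * (z * C * s) ^ n / n.factorial := by
  induction n with
  | zero => simpa using hB
  | succ n ih =>
    have hd : ∀ s ∈ Icc (0 : ℝ) 1, HasDerivAt
        (fun t => F t - ∑ k ∈ Finset.range (n + 1), z ^ k • picardCoeff M k t)
        (z • ((F s - ∑ k ∈ Finset.range n, z ^ k • picardCoeff M k s) * M s)) s := by
      intro s hs
      have h1 : HasDerivAt (fun t => ∑ k ∈ Finset.range n, z ^ (k + 1) • picardCoeff M (k + 1) t)
          (∑ k ∈ Finset.range n, z ^ (k + 1) • (picardCoeff M k s * M s)) s :=
        HasDerivAt.fun_sum fun k _ => (hasDerivAt_picardCoeff_succ hM k s).fun_const_smul _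
      have h2 := ((hF s hs).fun_sub h1).sub_const (1 : 𝔸)
      have he : (fun t => F t - ∑ k ∈ Finset.range (n + 1), z ^ k • picardCoeff M k t) =
          fun t => F t - ∑ k ∈ Finset.range n, z ^ (k + 1) • picardCoeff M (k + 1) t - 1 := by
        funext t
        rw [Finset.sum_range_succ', pow_zero, one_smul, sub_sub]
        rfl
      rw [he]
      refine h2.congr_deriv ?_
      rw [sub_mul, smul_sub, Finset.sum_mul, Finset.smul_sum]
      congr 1
      refine Finset.sum_congr rfl fun k _ => ?_
      rw [smul_mul_assoc, smul_smul, pow_succ']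
    have hbd : ∀ s : ℝ, HasDerivAt (fun t => B * (z * C * t) ^ (n + 1) / (n + 1).factorial)
        (z * C * (B * (z * C * s) ^ n / n.factorial)) s := by
      intro s
      have h := ((((hasDerivAt_id s).const_mul (z * C)).fun_pow (n + 1)).const_mul B).div_const
        ((n + 1).factorial : ℝ)
      refine h.congr_deriv ?_
      simp only [Nat.factorial_succ, Nat.cast_mul, add_tsub_cancel_right, id, mul_one]
      field_simp
    refine image_norm_le_of_norm_deriv_right_le_deriv_boundary
      (f' := fun s => z • ((F s - ∑ k ∈ Finset.range n, z ^ k • picardCoeff M k s) * M s))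
      (B' := fun s => z * C * (B * (z * C * s) ^ n / n.factorial))
      (fun s hs => (hd s hs).continuousAt.continuousWithinAt)
      (fun s hs => (hd s (Ico_subset_Icc_self hs)).hasDerivWithinAt) ?_ hbd ?_
    · rw [Finset.sum_range_succ']
      simp [hF0, picardCoeff]
    · intro s hs
      have hs' := Ico_subset_Icc_self hs
      have h0 : 0 ≤ B * (z * C * s) ^ n / n.factorial := (norm_nonneg _).trans (ih s hs')
      rw [norm_smul, Real.norm_of_nonneg hz, mul_assoc, mul_comm C]
      exact mul_le_mul_of_nonneg_left ((norm_mul_le _ _).trans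
        (mul_le_mul (ih s hs') (hC s hs') (norm_nonneg _) h0)) hz

lemma hasSum_picardCoeff [CompleteSpace 𝔸] {M F : ℝ → 𝔸} (hM : Continuous M) {z : ℝ} (hz : 0 ≤ z)
    (hF0 : F 0 = 1) (hF : ∀ s ∈ Icc (0 : ℝ) 1, HasDerivAt F (z • (F s * M s)) s) :
    HasSum (fun k => z ^ k • picardCoeff M k 1) (F 1) := by
  obtain ⟨B, hB⟩ := isCompact_Icc.exists_bound_of_continuousOn
    (fun s hs => (hF s hs).continuousAt.continuousWithinAt)
  obtain ⟨C, hC⟩ := isCompact_Icc.exists_bound_of_continuousOn (s := Icc (0 : ℝ) 1)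
    hM.continuousOn
  have hr := fun n => norm_sub_sum_picardCoeff_le hM hz hF0 hF hB hC n 1 (by simp)
  have hsum : Summable fun n : ℕ => B * (z * C * 1) ^ n / n.factorial := by
    simp_rw [mul_div_assoc]
    exact (Real.summable_pow_div_factorial _).mul_left B
  have hlim : Tendsto (fun n => ∑ k ∈ Finset.range n, z ^ k • picardCoeff M k 1) atTop
      (𝓝 (F 1)) := by
    rw [tendsto_iff_norm_sub_tendsto_zero]
    refine squeeze_zero (fun _ => norm_nonneg _) (fun n => ?_) hsum.tendsto_atTop_zero
    rw [norm_sub_rev]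
    exact hr n
  have hs : Summable fun k => z ^ k • picardCoeff M k 1 := by
    refine Summable.of_norm_bounded (hsum.add ((summable_nat_add_iff 1).2 hsum)) fun n => ?_
    have : z ^ n • picardCoeff M n 1 =
        (F 1 - ∑ k ∈ Finset.range n, z ^ k • picardCoeff M k 1) -
        (F 1 - ∑ k ∈ Finset.range (n + 1), z ^ k • picardCoeff M k 1) := by
      rw [Finset.sum_range_succ]; abel
    rw [this]
    exact (norm_sub_le _ _).trans (add_le_add (hr n) (hr (n + 1)))
  exact hs.hasSum_iff_tendsto_nat.2 hlim

/-- The solution at time `1` of `F' = z F M`, `F 0 = 1`, is an entire power series in `z`; if `M`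
is odd under conjugation by the involution `p`, its coefficients are even or odd with their
degree. -/
lemma exists_coeff_of_hasDerivAt [CompleteSpace 𝔸] {M : ℝ → 𝔸} (hM : ContinuousOn M (Icc 0 1))
    {p : 𝔸} (hp : p * p = 1) (hpM : ∀ s ∈ Icc (0 : ℝ) 1, p * M s * p = -M s) (F : ℝ → ℝ → 𝔸)
    (hF0 : ∀ z > 0, F z 0 = 1)
    (hF : ∀ z > 0, ∀ s ∈ Icc (0 : ℝ) 1, HasDerivAt (F z) (z • (F z s * M s)) s) :
    ∃ a : ℕ → 𝔸, a 0 = 1 ∧ (∀ k, p * a k * p = (-1 : ℝ) ^ k • a k) ∧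
      ∀ z > 0, HasSum (fun k => z ^ k • a k) (F z 1) := by
  set N : ℝ → 𝔸 := fun s => M (projIcc 0 1 zero_le_one s) with hN
  have hNc : Continuous N :=
    (continuousOn_iff_continuous_domRestrict.1 hM).comp continuous_projIcc
  have hNM : ∀ s ∈ Icc (0 : ℝ) 1, N s = M s := fun s hs => by simp [hN, projIcc_of_mem _ hs]
  refine ⟨fun k => picardCoeff N k 1, rfl, fun k => conj_picardCoeff hNc hp
    (fun s => hpM _ (projIcc 0 1 zero_le_one s).2) k 1, fun z hz =>
      hasSum_picardCoeff hNc hz.le (hF0 z hz) fun s hs => ?_⟩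
  rw [hNM s hs]
  exact hF z hz s hs

end Picard

section
attribute [local instance] Matrix.linftyOpNormedRing Matrix.linftyOpNormedAlgebra

lemma exists_matrix_coeff {M : ℝ → M3} (hM : ContinuousOn M (Icc 0 1))
    {p : M3} (hp : p * p = 1) (hpM : ∀ s ∈ Icc (0 : ℝ) 1, p * M s * p = -M s) (F : ℝ → ℝ → M3)
    (hF0 : ∀ z > 0, F z 0 = 1)
    (hF : ∀ z > 0, ∀ s ∈ Icc (0 : ℝ) 1, HasDerivAt (F z) (z • (F z s * M s)) s) :
    ∃ a : ℕ → M3, a 0 = 1 ∧ (∀ k, p * a k * p = (-1 : ℝ) ^ k • a k) ∧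
      ∀ z > 0, HasSum (fun k => z ^ k • a k) (F z 1) :=
  exists_coeff_of_hasDerivAt hM hp hpM F hF0 hF

end

/-- The matrix function `f` on `(0, ∞)` extends to an entire function with the value `c` at `0`. -/
def HasEntireExtension (f : ℝ → M3) (c : M3) : Prop :=
  ∃ F : ℂ → Matrix (Fin 3) (Fin 3) ℂ, (∀ i j, Differentiable ℂ fun z => F z i j) ∧
    F 0 = c.map Complex.ofReal ∧ ∀ l : ℝ, 0 < l → F l = (f l).map Complex.ofReal

lemma HasEntireExtension.mul {f g : ℝ → M3} {c d : M3} (hf : HasEntireExtension f c)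
    (hg : HasEntireExtension g d) : HasEntireExtension (fun l => f l * g l) (c * d) := by
  obtain ⟨F, hF, hF0, hFl⟩ := hf
  obtain ⟨G, hG, hG0, hGl⟩ := hg
  refine ⟨fun z => F z * G z, fun i j => ?_, ?_, fun l hl => ?_⟩
  · simp only [Matrix.mul_apply]
    exact Differentiable.fun_sum fun k _ => (hF i k).mul (hG k j)
  · simp only [hF0, hG0]
    exact (Matrix.map_mul (f := Complex.ofRealHom)).symm
  · simp only [hFl l hl, hGl l hl]
    exact (Matrix.map_mul (f := Complex.ofRealHom)).symm

lemma HasEntireExtension.transpose {f : ℝ → M3} {c : M3} (hf : HasEntireExtension f c) :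
    HasEntireExtension (fun l => (f l).transpose) c.transpose := by
  obtain ⟨F, hF, hF0, hFl⟩ := hf
  exact ⟨fun z => (F z).transpose, fun i j => hF j i, by simp [hF0, Matrix.transpose_map],
    fun l hl => by simp [hFl l hl, Matrix.transpose_map]⟩

lemma differentiable_tsum_mul_pow {a : ℕ → ℝ} (ha : ∀ l : ℝ, 0 < l → Summable fun k => l ^ k * a k) :
    Differentiable ℂ fun z : ℂ => ∑' k, z ^ k * (a k : ℂ) := by
  intro z
  have hR : 0 < ‖z‖ + 1 := by positivity
  have hd : DifferentiableOn ℂ (fun z : ℂ => ∑' k, z ^ k * (a k : ℂ)) (Metric.ball 0 (‖z‖ + 1)) := by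
    refine Complex.differentiableOn_tsum_of_summable_norm (ha _ hR).norm (fun k => ?_)
      Metric.isOpen_ball fun k w hw => ?_
    · exact ((differentiable_id.pow k).mul_const _).differentiableOn
    · rw [norm_mul, norm_mul, norm_pow, norm_pow, Complex.norm_real, Real.norm_of_nonneg hR.le]
      gcongr
      exact (mem_ball_zero_iff.1 hw).le
  exact hd.differentiableAt (Metric.isOpen_ball.mem_nhds (by simp))

lemma hasSum_entry {a : ℕ → M3} {l : ℝ} {g : M3} (h : HasSum (fun k => l ^ k • a k) g)
    (i j : Fin 3) : HasSum (fun k => l ^ k * a k i j) (g i j) := by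
  have h1 := Pi.hasSum.1 (Pi.hasSum.1 h i) j
  simpa using h1

lemma hasEntireExtension_of_hasSum {f : ℝ → M3} {a : ℕ → M3}
    (h : ∀ l : ℝ, 0 < l → HasSum (fun k => l ^ k • a k) (f l)) : HasEntireExtension f (a 0) := by
  refine ⟨fun z => Matrix.of fun i j => ∑' k, z ^ k * (a k i j : ℂ), fun i j => ?_, ?_,
    fun l hl => ?_⟩
  · exact differentiable_tsum_mul_pow fun l hl => (hasSum_entry (h l hl) i j).summable
  · ext i j
    change ∑' k, (0 : ℂ) ^ k * (a k i j : ℂ) = (a 0 i j : ℂ)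
    rw [tsum_eq_single 0 fun k hk => by simp [hk]]
    simp
  · ext i j
    have := Complex.hasSum_ofReal.2 (hasSum_entry (h l hl) i j)
    simpa using this.tsum_eq

/-- A function which is entire in `l` and entire in `l⁻¹` is constant. -/
lemma HasEntireExtension.eq_of_inv {f g : ℝ → M3} {c d : M3} (hf : HasEntireExtension f c)
    (hg : HasEntireExtension (fun l => g l⁻¹) d) (hfg : ∀ l : ℝ, 0 < l → f l = g l) {l : ℝ}
    (hl : 0 < l) : f l = c := by
  obtain ⟨F, hF, hF0, hFl⟩ := hf
  obtain ⟨G, hG, hG0, hGl⟩ := hg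
  have key : ∀ i j, ∀ z : ℂ, F z i j = F 0 i j := by
    intro i j
    have heq : EqOn (fun z => F z i j) (fun z => G z⁻¹ i j) {0}ᶜ := by
      refine AnalyticOnNhd.eqOn_of_preconnected_of_frequently_eq (z₀ := 1)
        (((hF i j).differentiableOn).analyticOnNhd isOpen_compl_singleton)
        (DifferentiableOn.analyticOnNhd ?_ isOpen_compl_singleton)
        (isConnected_compl_singleton_of_one_lt_rank (by simp) 0).isPreconnected (by simp) ?_
      · exact (hG i j).comp_differentiableOn (differentiableOn_inv.mono fun z hz => hz)
      · have hev : ∀ᶠ t : ℝ in 𝓝[≠] 1, F (t : ℂ) i j = G (t : ℂ)⁻¹ i j := by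
          filter_upwards [nhdsWithin_le_nhds (lt_mem_nhds zero_lt_one)] with t ht
          have := hGl t⁻¹ (inv_pos.2 ht)
          simp only [inv_inv] at this
          rw [← hfg t ht, ← hFl t ht] at this
          rw [← this]; simp
        have ht : Tendsto (fun t : ℝ => (t : ℂ)) (𝓝[≠] 1) (𝓝[≠] 1) := by
          refine tendsto_nhdsWithin_iff.2 ⟨?_, ?_⟩
          · exact (Complex.continuous_ofReal.tendsto' 1 1 (by simp)).mono_left nhdsWithin_le_nhds
          · filter_upwards [self_mem_nhdsWithin] with t ht
            simpa using ht
        exact ht.frequently hev.frequently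
    have hlim : Tendsto (fun z => F z i j) (cocompact ℂ) (𝓝 (G 0 i j)) := by
      have h1 : Tendsto (fun z : ℂ => G z⁻¹ i j) (cocompact ℂ) (𝓝 (G 0 i j)) := by
        refine ((hG i j).continuous.tendsto 0).comp ?_
        rw [← Metric.cobounded_eq_cocompact]
        exact tendsto_inv₀_cobounded
      refine h1.congr' ?_
      filter_upwards [(isCompact_singleton (x := (0 : ℂ))).compl_mem_cocompact] with z hz
      exact (heq hz).symm
    intro z
    rw [(hF i j).apply_eq_of_tendsto_cocompact z hlim, (hF i j).apply_eq_of_tendsto_cocompact 0 hlim]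
  ext i j
  have := key i j l
  rw [hFl l hl, hF0] at this
  simpa using this

lemma mul_transpose_of_mem_SO3 {g : M3} (hg : g ∈ SO3) : g * g.transpose = 1 :=
  (Matrix.mem_orthogonalGroup_iff (Fin 3) ℝ).1 (Matrix.mem_specialOrthogonalGroup_iff.1 hg).1

lemma transpose_mul_of_mem_SO3 {g : M3} (hg : g ∈ SO3) : g.transpose * g = 1 :=
  (Matrix.mem_orthogonalGroup_iff' (Fin 3) ℝ).1 (Matrix.mem_specialOrthogonalGroup_iff.1 hg).1

lemma mul_mem_SO3 {g h : M3} (hg : g ∈ SO3) (hh : h ∈ SO3) : g * h ∈ SO3 :=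
  (Matrix.specialOrthogonalGroup (Fin 3) ℝ).mul_mem hg hh

lemma transpose_mem_SO3 {g : M3} (hg : g ∈ SO3) : g.transpose ∈ SO3 := by
  refine Matrix.mem_specialOrthogonalGroup_iff.2
    ⟨(Matrix.mem_orthogonalGroup_iff (Fin 3) ℝ).2 ?_, ?_⟩
  · simpa using transpose_mul_of_mem_SO3 hg
  · rw [Matrix.det_transpose]; exact (Matrix.mem_specialOrthogonalGroup_iff.1 hg).2

lemma inv_eq_transpose_of_mem_SO3 {g : M3} (hg : g ∈ SO3) : g⁻¹ = g.transpose :=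
  Matrix.inv_eq_right_inv (mul_transpose_of_mem_SO3 hg)

/-- Uniqueness in the Birkhoff factorization: a product of a function entire in `l`, equal to `1`
at `l = 0`, and a function entire in `l⁻¹` determines its first factor. -/
lemma birkhoff_unique {A A' B B' : ℝ → M3} {b b' : M3} (hA : HasEntireExtension A 1)
    (hA' : HasEntireExtension A' 1) (hB : HasEntireExtension (fun l => B l⁻¹) b)
    (hB' : HasEntireExtension (fun l => B' l⁻¹) b') (mA : ∀ l : ℝ, 0 < l → A l ∈ SO3)
    (mA' : ∀ l : ℝ, 0 < l → A' l ∈ SO3) (mB : ∀ l : ℝ, 0 < l → B l ∈ SO3)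
    (h : ∀ l : ℝ, 0 < l → A l * B l = A' l * B' l) {l : ℝ} (hl : 0 < l) :
    A l = A' l ∧ B l = B' l := by
  have key : (A' l).transpose * A l = 1 := by
    have := (hA'.transpose.mul hA).eq_of_inv (g := fun l => B' l * (B l).transpose)
      (hB'.mul hB.transpose) (fun l hl => ?_) hl
    · simpa using this
    · calc (A' l).transpose * A l
          = (A' l).transpose * (A l * B l) * (B l).transpose := by
            rw [mul_assoc, mul_assoc, mul_transpose_of_mem_SO3 (mB l hl), mul_one]
        _ = ((A' l).transpose * A' l) * B' l * (B l).transpose := by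
            rw [h l hl]; simp only [mul_assoc]
        _ = _ := by rw [transpose_mul_of_mem_SO3 (mA' l hl), one_mul]
  have h1 : A l = A' l := by
    rw [← one_mul (A l), ← mul_transpose_of_mem_SO3 (mA' l hl), mul_assoc, key, mul_one]
  refine ⟨h1, ?_⟩
  have h2 := h l hl
  rw [← h1] at h2
  rw [← one_mul (B l), ← transpose_mul_of_mem_SO3 (mA l hl), mul_assoc, h2, ← mul_assoc,
    transpose_mul_of_mem_SO3 (mA l hl), one_mul]

lemma IsTwistedLoop.hasEntireExtension {g : ℝ → M3} {a : ℤ → M3} (h : IsTwistedLoop g a)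
    (ha : ∀ k < 0, a k = 0) : HasEntireExtension g (a 0) := by
  refine hasEntireExtension_of_hasSum (a := fun k : ℕ => a k) fun l hl => ?_
  have := (Nat.cast_injective (R := ℤ)).hasSum_iff (f := fun k : ℤ => l ^ k • a k) (a := g l) ?_
  · simpa [Function.comp_def] using this.2 (h.hasSum l hl)
  · intro k hk
    have : k < 0 := by
      by_contra hk'
      exact hk ⟨k.toNat, by simpa using hk'⟩
    simp [ha k this]

lemma IsTwistedLoop.hasEntireExtension_inv {g : ℝ → M3} {a : ℤ → M3} (h : IsTwistedLoop g a)
    (ha : ∀ k > 0, a k = 0) : HasEntireExtension (fun l => g l⁻¹) (a 0) := by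
  refine hasEntireExtension_of_hasSum (a := fun k : ℕ => a (-k)) fun l hl => ?_
  have hinj : Function.Injective fun k : ℕ => -(k : ℤ) := fun k m hkm => by simpa using hkm
  have := hinj.hasSum_iff (f := fun k : ℤ => l⁻¹ ^ k • a k) (a := g l⁻¹) ?_
  · simpa [Function.comp_def] using this.2 (h.hasSum l⁻¹ (inv_pos.2 hl))
  · intro k hk
    have : 0 < k := by
      by_contra hk'
      exact hk ⟨(-k).toNat, by simp; omega⟩
    simp [ha k this]

lemma twistP_mul_self : twistP * twistP = 1 := by
  rw [twistP, Matrix.diagonal_mul_diagonal, ← Matrix.diagonal_one]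
  congr 1; ext i; fin_cases i <;> simp

lemma twistP_inv : twistP⁻¹ = twistP := Matrix.inv_eq_right_inv twistP_mul_self

/-- The coefficients of a power series, indexed by all integers. -/
def extendCoeff (a : ℕ → M3) (k : ℤ) : M3 := if 0 ≤ k then a k.toNat else 0

lemma hasSum_extendCoeff {a : ℕ → M3} {l : ℝ} {g : M3} (h : HasSum (fun k => l ^ k • a k) g) :
    HasSum (fun k : ℤ => l ^ k • extendCoeff a k) g := by
  refine ((Nat.cast_injective (R := ℤ)).hasSum_iff ?_).1 ?_
  · intro k hk
    have : ¬ 0 ≤ k := fun hk' => hk ⟨k.toNat, by simpa using hk'⟩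
    simp [extendCoeff, this]
  · simpa [Function.comp_def, extendCoeff] using h

lemma conj_extendCoeff {a : ℕ → M3} (h : ∀ k, twistP * a k * twistP = (-1 : ℝ) ^ k • a k) (k : ℤ) :
    twistP * extendCoeff a k * twistP⁻¹ = (-1 : ℝ) ^ k • extendCoeff a k := by
  rw [twistP_inv]
  by_cases hk : 0 ≤ k
  · lift k to ℕ using hk
    simpa [extendCoeff] using h k
  · simp [extendCoeff, hk]

lemma isTwistedLoop_plus {g : ℝ → M3} {a : ℕ → M3} (hg : ∀ l : ℝ, 0 < l → g l ∈ SO3)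
    (h : ∀ k, twistP * a k * twistP = (-1 : ℝ) ^ k • a k)
    (hs : ∀ l : ℝ, 0 < l → HasSum (fun k => l ^ k • a k) (g l)) :
    IsTwistedLoop g (extendCoeff a) :=
  ⟨hg, fun l hl => hasSum_extendCoeff (hs l hl), conj_extendCoeff h⟩

lemma isTwistedLoop_minus {g : ℝ → M3} {a : ℕ → M3} (hg : ∀ l : ℝ, 0 < l → g l ∈ SO3)
    (h : ∀ k, twistP * a k * twistP = (-1 : ℝ) ^ k • a k)
    (hs : ∀ l : ℝ, 0 < l → HasSum (fun k => l⁻¹ ^ k • a k) (g l)) :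
    IsTwistedLoop g fun k => extendCoeff a (-k) := by
  refine ⟨hg, fun l hl => ?_, fun k => ?_⟩
  · have := (Equiv.neg ℤ).hasSum_iff.2 (hasSum_extendCoeff (hs l hl))
    simpa [Function.comp_def] using this
  · have hk : (-1 : ℝ) ^ (-k) = (-1) ^ k := by rw [← inv_zpow', inv_neg_one]
    rw [conj_extendCoeff h (-k), hk]

/-- The rotation by the angle `r` about `e₃`. -/
noncomputable def rot (r : ℝ) : M3 :=
  !![Real.cos r, -Real.sin r, 0; Real.sin r, Real.cos r, 0; 0, 0, 1]

/-- The infinitesimal rotation about `e₃`. -/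
def rotGen : M3 := !![0, -1, 0; 1, 0, 0; 0, 0, 0]

lemma rot_mem_rotK (r : ℝ) : rot r ∈ rotK := ⟨r, rfl⟩

lemma rot_zero : rot 0 = 1 := by
  ext i j; fin_cases i <;> fin_cases j <;> simp [rot]

lemma rot_transpose (r : ℝ) : (rot r).transpose = rot (-r) := by
  ext i j; fin_cases i <;> fin_cases j <;> simp [rot]

lemma rot_add (r s : ℝ) : rot (r + s) = rot r * rot s := by
  ext i j
  fin_cases i <;> fin_cases j <;>
    simp [rot, Matrix.mul_apply, Fin.sum_univ_three, Real.cos_add, Real.sin_add] <;> ring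

lemma rot_mul_rot_of_add_eq_zero {r s : ℝ} (h : r + s = 0) : rot r * rot s = 1 := by
  rw [← rot_add, h, rot_zero]

lemma rot_mem_SO3 (r : ℝ) : rot r ∈ SO3 := by
  refine Matrix.mem_specialOrthogonalGroup_iff.2
    ⟨(Matrix.mem_orthogonalGroup_iff (Fin 3) ℝ).2 ?_, ?_⟩
  · rw [rot_transpose, rot_mul_rot_of_add_eq_zero (by ring)]
  · rw [rot, Matrix.det_fin_three]
    simp
    nlinarith [Real.sin_sq_add_cos_sq r]

lemma one_mem_SO3 : (1 : M3) ∈ SO3 := rot_zero ▸ rot_mem_SO3 0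

lemma twistP_mul_rot (r : ℝ) : twistP * rot r = rot r * twistP := by
  ext i j
  fin_cases i <;> fin_cases j <;> simp [rot, twistP]

lemma twistP_conj_alphaOne (p : ℝ × ℝ) : twistP * alphaOne p * twistP = -alphaOne p := by
  ext i j
  fin_cases i <;> fin_cases j <;> simp [alphaOne, twistP]

lemma twistP_conj_alphaNegOne (φ : ℝ × ℝ → ℝ) (p : ℝ × ℝ) :
    twistP * alphaNegOne φ p * twistP = -alphaNegOne φ p := by
  ext i j
  fin_cases i <;> fin_cases j <;> simp [alphaNegOne, twistP]

lemma laxA_eq (φ : ℝ × ℝ → ℝ) (p : ℝ × ℝ) (l : ℝ) :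
    laxA φ p l = dX φ p • rotGen - l • alphaOne p := by
  ext i j
  fin_cases i <;> fin_cases j <;> simp [laxA, rotGen, alphaOne]

lemma laxB_eq (φ : ℝ × ℝ → ℝ) (p : ℝ × ℝ) (l : ℝ) :
    laxB φ p l = -(l⁻¹ • alphaNegOne φ p) := by
  ext i j
  fin_cases i <;> fin_cases j <;> simp [laxB, alphaNegOne]

lemma continuousOn_alphaNegOne {φ : ℝ × ℝ → ℝ} {s : Set ℝ} {γ : ℝ → ℝ × ℝ}
    (h : ContinuousOn (fun t => φ (γ t)) s) : ContinuousOn (fun t => alphaNegOne φ (γ t)) s := by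
  have he : (fun t => alphaNegOne φ (γ t)) = fun t =>
      Real.sin (φ (γ t)) • (!![0, 0, 1; 0, 0, 0; -1, 0, 0] : M3) +
        Real.cos (φ (γ t)) • (!![0, 0, 0; 0, 0, 1; 0, -1, 0] : M3) := by
    ext t i j
    fin_cases i <;> fin_cases j <;> simp [alphaNegOne]
  rw [he]
  exact ((Real.continuous_sin.comp_continuousOn h).smul continuousOn_const).add
    ((Real.continuous_cos.comp_continuousOn h).smul continuousOn_const)

section
attribute [local instance] Matrix.linftyOpNormedRing Matrix.linftyOpNormedAlgebra

lemma hasDerivAt_matrix_mul {f g : ℝ → M3} {f' g' : M3} {t : ℝ} (hf : HasDerivAt f f' t)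
    (hg : HasDerivAt g g' t) : HasDerivAt (fun s => f s * g s) (f' * g t + f t * g') t :=
  hf.mul hg

lemma hasDerivAt_matrix_const_mul (c : M3) {f : ℝ → M3} {f' : M3} {t : ℝ}
    (hf : HasDerivAt f f' t) : HasDerivAt (fun s => c * f s) (c * f') t :=
  hf.const_mul c

lemma hasDerivAt_matrix_scomp {f : ℝ → M3} {f' : M3} (h : ℝ → ℝ) {h' t : ℝ}
    (hf : HasDerivAt f f' (h t)) (hh : HasDerivAt h h' t) :
    HasDerivAt (fun s => f (h s)) (h' • f') t :=
  HasDerivAt.scomp t hf hh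

lemma hasDerivAt_matrix_congr_deriv {f : ℝ → M3} {f' g' : M3} {t : ℝ} (hf : HasDerivAt f f' t)
    (h : f' = g') : HasDerivAt f g' t := h ▸ hf

lemma hasDerivAt_matrix_congr_of_eventuallyEq {f g : ℝ → M3} {f' : M3} {t : ℝ}
    (hf : HasDerivAt f f' t) (h : g =ᶠ[𝓝 t] f) : HasDerivAt g f' t :=
  HasDerivAt.congr_of_eventuallyEq hf h

lemma hasDerivAt_rot (r : ℝ) : HasDerivAt rot (rotGen * rot r) r := by
  have he : rot = fun t => Real.cos t • (!![1, 0, 0; 0, 1, 0; 0, 0, 0] : M3) +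
      Real.sin t • rotGen + (!![0, 0, 0; 0, 0, 0; 0, 0, 1] : M3) := by
    ext t i j
    fin_cases i <;> fin_cases j <;> simp [rot, rotGen]
  have h : HasDerivAt (fun t => Real.cos t • (!![1, 0, 0; 0, 1, 0; 0, 0, 0] : M3) +
      Real.sin t • rotGen + (!![0, 0, 0; 0, 0, 0; 0, 0, 1] : M3))
      (-Real.sin r • (!![1, 0, 0; 0, 1, 0; 0, 0, 0] : M3) + Real.cos r • rotGen) r :=
    (((Real.hasDerivAt_cos r).smul_const _).add
      ((Real.hasDerivAt_sin r).smul_const _)).add_const _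
  rw [← he] at h
  refine h.congr_deriv ?_
  ext i j
  fin_cases i <;> fin_cases j <;> simp [rot, rotGen, Matrix.mul_apply, Fin.sum_univ_three]

lemma continuous_rot : Continuous rot :=
  continuous_iff_continuousAt.2 fun r => (hasDerivAt_rot r).continuousAt

end

/-- The `x`-part of the Lax system after the gauge transformation by the rotation about `e₃` that
removes the term of degree zero in `l`. -/
lemma hasDerivAt_gauged_frame {D : Set (ℝ × ℝ)} (hD : IsOpen D) {φ : ℝ × ℝ → ℝ}
    (hφ : ContDiffOn ℝ ∞ φ D) {U : ℝ × ℝ → ℝ → M3} (hU : IsExtendedFrame D φ U) {x y : ℝ}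
    (hp : (x, y) ∈ D) {l : ℝ} (hl : 0 < l) (c : ℝ) :
    HasDerivAt (fun t => U (t, y) l * rot (c - φ (t, y)))
      (l • (U (x, y) l * rot (c - φ (x, y)) *
        -(rot (φ (x, y) - c) * alphaOne (x, y) * rot (c - φ (x, y))))) x := by
  have hφx : HasDerivAt (fun t => φ (t, y)) (dX φ (x, y)) x := by
    have h1 : DifferentiableAt ℝ φ (x, y) :=
      (hφ.contDiffAt (hD.mem_nhds hp)).differentiableAt (by simp)
    have h2 : DifferentiableAt ℝ (fun t : ℝ => φ (t, y)) x :=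
      h1.comp x (differentiableAt_id.prodMk (differentiableAt_const y))
    exact h2.hasDerivAt
  have hr := hasDerivAt_matrix_scomp (fun t => c - φ (t, y)) (hasDerivAt_rot (c - φ (x, y)))
    (hφx.const_sub c)
  refine hasDerivAt_matrix_congr_deriv (hasDerivAt_matrix_mul (hU.lax_x (x, y) hp l hl) hr) ?_
  have h1 := rot_mul_rot_of_add_eq_zero (r := c - φ (x, y)) (s := φ (x, y) - c) (by ring)
  have h2 : U (x, y) l * rot (c - φ (x, y)) *
        -(rot (φ (x, y) - c) * alphaOne (x, y) * rot (c - φ (x, y))) =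
      -(U (x, y) l * (rot (c - φ (x, y)) * rot (φ (x, y) - c)) * alphaOne (x, y) *
        rot (c - φ (x, y))) := by noncomm_ring
  rw [h2, h1, laxA_eq]
  simp only [mul_sub, sub_mul, Matrix.mul_smul, Matrix.smul_mul, mul_one, smul_neg, neg_smul,
    Matrix.mul_neg, mul_assoc]
  abel

lemma add_mul_sub_mem_uIcc {a b s : ℝ} (hs : s ∈ Icc (0 : ℝ) 1) : a + s * (b - a) ∈ uIcc a b := by
  obtain ⟨h0, h1⟩ := hs
  rcases le_total a b with h | h
  · rw [uIcc_of_le h]; constructor <;> nlinarith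
  · rw [uIcc_of_ge h]; constructor <;> nlinarith

lemma hasDerivAt_add_mul_sub (a b s : ℝ) : HasDerivAt (fun s => a + s * (b - a)) (b - a) s := by
  simpa using ((hasDerivAt_id s).mul_const (b - a)).const_add a

/-- Along a vertical segment the frame changes by an entire series in `l⁻¹`. -/
lemma exists_coeff_vertical {D : Set (ℝ × ℝ)} {φ : ℝ × ℝ → ℝ}
    (hφ : ContDiffOn ℝ ∞ φ D) {U : ℝ × ℝ → ℝ → M3} (hU : IsExtendedFrame D φ U) {x y y' : ℝ}
    (hseg : ∀ t ∈ uIcc y y', (x, t) ∈ D) :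
    ∃ a : ℕ → M3, a 0 = 1 ∧ (∀ k, twistP * a k * twistP = (-1 : ℝ) ^ k • a k) ∧
      ∀ l : ℝ, 0 < l →
        HasSum (fun k => l⁻¹ ^ k • a k) ((U (x, y) l).transpose * U (x, y') l) := by
  have hmem : ∀ s ∈ Icc (0 : ℝ) 1, (x, y + s * (y' - y)) ∈ D := fun s hs =>
    hseg _ (add_mul_sub_mem_uIcc hs)
  have hcont : ContinuousOn (fun s : ℝ => φ (x, y + s * (y' - y))) (Icc 0 1) :=
    hφ.continuousOn.comp (by fun_prop) hmem
  obtain ⟨a, ha0, hat, has⟩ := exists_matrix_coeff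
    (M := fun s => -((y' - y) • alphaNegOne φ (x, y + s * (y' - y))))
    ((continuousOn_alphaNegOne hcont).const_smul (y' - y)).neg twistP_mul_self
    (fun s _ => by
      simp only [mul_neg, neg_mul, Matrix.mul_smul, Matrix.smul_mul, twistP_conj_alphaNegOne,
        smul_neg])
    (fun z s => (U (x, y) z⁻¹).transpose * U (x, y + s * (y' - y)) z⁻¹)
    (fun z hz => by
      simpa using transpose_mul_of_mem_SO3 (hU.mem_SO3 (x, y) (hseg _ left_mem_uIcc) z⁻¹
        (inv_pos.2 hz)))
    (fun z hz s hs => by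
      have h1 := hasDerivAt_matrix_scomp (fun s => y + s * (y' - y))
        (hU.lax_y (x, y + s * (y' - y)) (hmem s hs) z⁻¹ (inv_pos.2 hz))
        (hasDerivAt_add_mul_sub y y' s)
      refine hasDerivAt_matrix_congr_deriv
        (hasDerivAt_matrix_const_mul (U (x, y) z⁻¹).transpose h1) ?_
      rw [laxB_eq, inv_inv]
      simp only [mul_neg, Matrix.mul_smul, smul_neg, mul_assoc]
      rw [smul_comm])
  refine ⟨a, ha0, hat, fun l hl => ?_⟩
  simpa using has l⁻¹ (inv_pos.2 hl)

/-- Along a horizontal segment the frame changes, up to a rotation about `e₃`, by an entire series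
in `l`. -/
lemma exists_coeff_horizontal {D : Set (ℝ × ℝ)} (hD : IsOpen D) {φ : ℝ × ℝ → ℝ}
    (hφ : ContDiffOn ℝ ∞ φ D) {U : ℝ × ℝ → ℝ → M3} (hU : IsExtendedFrame D φ U) {x x' y : ℝ}
    (hseg : ∀ t ∈ uIcc x x', (t, y) ∈ D) :
    ∃ a : ℕ → M3, a 0 = 1 ∧ (∀ k, twistP * a k * twistP = (-1 : ℝ) ^ k • a k) ∧
      ∀ l : ℝ, 0 < l → HasSum (fun k => l ^ k • a k)
        ((U (x, y) l).transpose * (U (x', y) l * rot (φ (x, y) - φ (x', y)))) := by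
  have hmem : ∀ s ∈ Icc (0 : ℝ) 1, (x + s * (x' - x), y) ∈ D := fun s hs =>
    hseg _ (add_mul_sub_mem_uIcc hs)
  have hcont : ContinuousOn (fun s : ℝ => φ (x + s * (x' - x), y)) (Icc 0 1) :=
    hφ.continuousOn.comp (by fun_prop) hmem
  obtain ⟨a, ha0, hat, has⟩ := exists_matrix_coeff
    (M := fun s => -((x' - x) • (rot (φ (x + s * (x' - x), y) - φ (x, y)) *
      alphaOne (x + s * (x' - x), y) * rot (φ (x, y) - φ (x + s * (x' - x), y)))))
    ((((continuous_rot.comp_continuousOn (hcont.sub continuousOn_const)).mul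
      continuousOn_const).mul
        (continuous_rot.comp_continuousOn (continuousOn_const.sub hcont))).const_smul
          (x' - x)).neg twistP_mul_self
    (fun s _ => by
      have h : ∀ r r' p, twistP * (rot r * alphaOne p * rot r') * twistP =
          -(rot r * alphaOne p * rot r') := fun r r' p => by
        calc twistP * (rot r * alphaOne p * rot r') * twistP
            = (twistP * rot r) * alphaOne p * (rot r' * twistP) := by noncomm_ring
          _ = rot r * (twistP * alphaOne p * twistP) * rot r' := by
            rw [twistP_mul_rot r, ← twistP_mul_rot r']; simp only [mul_assoc]
          _ = _ := by rw [twistP_conj_alphaOne]; noncomm_ring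
      simp only [mul_neg, neg_mul, Matrix.mul_smul, Matrix.smul_mul, h, smul_neg])
    (fun z s => (U (x, y) z).transpose *
      (U (x + s * (x' - x), y) z * rot (φ (x, y) - φ (x + s * (x' - x), y))))
    (fun z hz => by
      simpa [rot_zero] using transpose_mul_of_mem_SO3 (hU.mem_SO3 (x, y) (hseg _ left_mem_uIcc) z
        hz))
    (fun z hz s hs => by
      have h1 := hasDerivAt_matrix_scomp (fun s => x + s * (x' - x))
        (hasDerivAt_gauged_frame hD hφ hU (hmem s hs) hz (φ (x, y)))
        (hasDerivAt_add_mul_sub x x' s)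
      refine hasDerivAt_matrix_congr_deriv
        (hasDerivAt_matrix_const_mul (U (x, y) z).transpose h1) ?_
      simp only [mul_neg, Matrix.mul_smul, smul_neg, mul_assoc]
      rw [smul_comm])
  refine ⟨a, ha0, hat, fun l hl => ?_⟩
  simpa using has l hl

lemma IsTwistedLoop.rot_mul {g : ℝ → M3} {a : ℤ → M3} (h : IsTwistedLoop g a) (r : ℝ) :
    IsTwistedLoop (fun l => rot r * g l) fun k => rot r * a k := by
  refine ⟨fun l hl => mul_mem_SO3 (rot_mem_SO3 r) (h.mem_SO3 l hl), fun l hl => ?_, fun k => ?_⟩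
  · simpa only [Matrix.mul_smul] using (h.hasSum l hl).mul_left (rot r)
  · rw [← mul_assoc, twistP_mul_rot, mul_assoc, mul_assoc, ← mul_assoc twistP, h.twisted,
      Matrix.mul_smul]

lemma IsTwistedLoop.mul_rot {g : ℝ → M3} {a : ℤ → M3} (h : IsTwistedLoop g a) (r : ℝ) :
    IsTwistedLoop (fun l => g l * rot r) fun k => a k * rot r := by
  refine ⟨fun l hl => mul_mem_SO3 (h.mem_SO3 l hl) (rot_mem_SO3 r), fun l hl => ?_, fun k => ?_⟩
  · simpa only [Matrix.smul_mul] using (h.hasSum l hl).mul_right (rot r)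
  · have ht := h.twisted k
    rw [twistP_inv] at ht ⊢
    rw [mul_assoc, mul_assoc, ← twistP_mul_rot, ← mul_assoc, ← mul_assoc, ht, Matrix.smul_mul]

lemma rot_mul_mem_LoopMinus {g : ℝ → M3} (hg : g ∈ LoopMinusStar) (r : ℝ) :
    (fun l => rot r * g l) ∈ LoopMinus := by
  obtain ⟨a, ha, hk, h0⟩ := hg
  exact ⟨_, ha.rot_mul r, fun k hk' => by simp [hk k hk'], by simpa [h0] using rot_mem_rotK r⟩

lemma mul_rot_mem_LoopPlus {g : ℝ → M3} (hg : g ∈ LoopPlusStar) (r : ℝ) :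
    (fun l => g l * rot r) ∈ LoopPlus := by
  obtain ⟨a, ha, hk, h0⟩ := hg
  exact ⟨_, ha.mul_rot r, fun k hk' => by simp [hk k hk'], by simpa [h0] using rot_mem_rotK r⟩

lemma LoopMinusStar_mem_SO3 {g : ℝ → M3} (hg : g ∈ LoopMinusStar) {l : ℝ} (hl : 0 < l) :
    g l ∈ SO3 := hg.choose_spec.1.mem_SO3 l hl

lemma LoopPlusStar_mem_SO3 {g : ℝ → M3} (hg : g ∈ LoopPlusStar) {l : ℝ} (hl : 0 < l) :
    g l ∈ SO3 := hg.choose_spec.1.mem_SO3 l hl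

lemma LoopMinus_mem_SO3 {g : ℝ → M3} (hg : g ∈ LoopMinus) {l : ℝ} (hl : 0 < l) :
    g l ∈ SO3 := hg.choose_spec.1.mem_SO3 l hl

lemma LoopPlus_mem_SO3 {g : ℝ → M3} (hg : g ∈ LoopPlus) {l : ℝ} (hl : 0 < l) :
    g l ∈ SO3 := hg.choose_spec.1.mem_SO3 l hl

lemma LoopPlusStar_hasEntireExtension {g : ℝ → M3} (hg : g ∈ LoopPlusStar) :
    HasEntireExtension g 1 := by
  obtain ⟨a, ha, hk, h0⟩ := hg
  exact h0 ▸ ha.hasEntireExtension hk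

lemma LoopMinusStar_hasEntireExtension {g : ℝ → M3} (hg : g ∈ LoopMinusStar) :
    HasEntireExtension (fun l => g l⁻¹) 1 := by
  obtain ⟨a, ha, hk, h0⟩ := hg
  exact h0 ▸ ha.hasEntireExtension_inv hk

lemma LoopPlus_hasEntireExtension {g : ℝ → M3} (hg : g ∈ LoopPlus) :
    ∃ c, HasEntireExtension g c := by
  obtain ⟨a, ha, hk, -⟩ := hg
  exact ⟨_, ha.hasEntireExtension hk⟩

lemma LoopMinus_hasEntireExtension {g : ℝ → M3} (hg : g ∈ LoopMinus) :
    ∃ c, HasEntireExtension (fun l => g l⁻¹) c := by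
  obtain ⟨a, ha, hk, -⟩ := hg
  exact ⟨_, ha.hasEntireExtension_inv hk⟩

/-- Multiplying a loop from the right by `h ∈ Λ⁻` keeps the first factor of its splitting in
`Λ⁺⋆ · Λ⁻` and multiplies the second by `h`. -/
lemma SplitPlusMinus.unique {g g' h gp gm gp' gm' : ℝ → M3} (hs : SplitPlusMinus g gp gm)
    (hs' : SplitPlusMinus g' gp' gm') (hh : h ∈ LoopMinus)
    (hg : ∀ l : ℝ, 0 < l → g' l = g l * h l) {l : ℝ} (hl : 0 < l) :
    gp l = gp' l ∧ gm l * h l = gm' l := by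
  obtain ⟨b, hb⟩ := LoopMinus_hasEntireExtension hs.2.1
  obtain ⟨c, hc⟩ := LoopMinus_hasEntireExtension hh
  obtain ⟨b', hb'⟩ := LoopMinus_hasEntireExtension hs'.2.1
  refine birkhoff_unique (B := fun l => gm l * h l) (LoopPlusStar_hasEntireExtension hs.1)
    (LoopPlusStar_hasEntireExtension hs'.1) (hb.mul hc) hb'
    (fun l hl => LoopPlusStar_mem_SO3 hs.1 hl) (fun l hl => LoopPlusStar_mem_SO3 hs'.1 hl)
    (fun l hl => mul_mem_SO3 (LoopMinus_mem_SO3 hs.2.1 hl) (LoopMinus_mem_SO3 hh hl))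
    (fun l hl => ?_) hl
  rw [← hs'.2.2 l hl, hg l hl, hs.2.2 l hl, mul_assoc]

/-- Multiplying a loop from the right by `h ∈ Λ⁺` keeps the first factor of its splitting in
`Λ⁻⋆ · Λ⁺` and multiplies the second by `h`. -/
lemma SplitMinusPlus.unique {g g' h gp gm gp' gm' : ℝ → M3} (hs : SplitMinusPlus g gm gp)
    (hs' : SplitMinusPlus g' gm' gp') (hh : h ∈ LoopPlus)
    (hg : ∀ l : ℝ, 0 < l → g' l = g l * h l) {l : ℝ} (hl : 0 < l) :
    gm l = gm' l ∧ gp l * h l = gp' l := by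
  obtain ⟨b, hb⟩ := LoopPlus_hasEntireExtension hs.2.1
  obtain ⟨c, hc⟩ := LoopPlus_hasEntireExtension hh
  obtain ⟨b', hb'⟩ := LoopPlus_hasEntireExtension hs'.2.1
  have key := birkhoff_unique (A := fun l => gm l⁻¹) (A' := fun l => gm' l⁻¹)
    (B := fun l => gp l⁻¹ * h l⁻¹) (B' := fun l => gp' l⁻¹) (b := b * c) (b' := b')
    (LoopMinusStar_hasEntireExtension hs.1) (LoopMinusStar_hasEntireExtension hs'.1)
    (by simpa only [inv_inv] using hb.mul hc) (by simpa only [inv_inv] using hb')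
    (fun l hl => LoopMinusStar_mem_SO3 hs.1 (inv_pos.2 hl))
    (fun l hl => LoopMinusStar_mem_SO3 hs'.1 (inv_pos.2 hl))
    (fun l hl => mul_mem_SO3 (LoopPlus_mem_SO3 hs.2.1 (inv_pos.2 hl))
      (LoopPlus_mem_SO3 hh (inv_pos.2 hl)))
    (fun l hl => by
      have hl := inv_pos.2 hl
      simp only [← hs'.2.2 _ hl, hg _ hl, hs.2.2 _ hl, mul_assoc]) (inv_pos.2 hl)
  simpa only [inv_inv] using key

lemma one_mem_LoopMinusStar : (fun _ => 1 : ℝ → M3) ∈ LoopMinusStar := by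
  refine ⟨_, isTwistedLoop_minus (a := fun k => if k = 0 then 1 else 0) (fun _ _ => one_mem_SO3)
    (fun k => ?_) (fun l _ => ?_), fun k hk => ?_, ?_⟩
  · rcases eq_or_ne k 0 with rfl | hk
    · simpa using twistP_mul_self
    · simp [hk]
  · convert hasSum_single (f := fun k => l⁻¹ ^ k • (if k = 0 then 1 else 0 : M3)) 0 ?_ using 1
    · simp
    · intro k hk; simp [hk]
  · simp [extendCoeff, hk]
  · simp [extendCoeff]

lemma one_mem_LoopMinus : (fun _ => 1 : ℝ → M3) ∈ LoopMinus := by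
  simpa [rot_zero] using rot_mul_mem_LoopMinus one_mem_LoopMinusStar 0

lemma one_mem_LoopPlus : (fun _ => 1 : ℝ → M3) ∈ LoopPlus := by
  refine ⟨_, isTwistedLoop_plus (a := fun k => if k = 0 then 1 else 0) (fun _ _ => one_mem_SO3)
    (fun k => ?_) (fun l _ => ?_), fun k hk => ?_, ?_⟩
  · rcases eq_or_ne k 0 with rfl | hk
    · simpa using twistP_mul_self
    · simp [hk]
  · convert hasSum_single (f := fun k => l ^ k • (if k = 0 then 1 else 0 : M3)) 0 ?_ using 1
    · simp
    · intro k hk; simp [hk]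
  · simp [extendCoeff, hk]
  · simpa [extendCoeff, rot_zero] using rot_mem_rotK 0

section Frame

variable {D : Set (ℝ × ℝ)} {φ : ℝ × ℝ → ℝ} {U : ℝ × ℝ → ℝ → M3}

lemma vertical_mem_LoopMinusStar (hφ : ContDiffOn ℝ ∞ φ D) (hU : IsExtendedFrame D φ U)
    {x y y' : ℝ} (hseg : ∀ t ∈ uIcc y y', (x, t) ∈ D) :
    (fun l => (U (x, y) l).transpose * U (x, y') l) ∈ LoopMinusStar := by
  obtain ⟨a, h0, ht, hs⟩ := exists_coeff_vertical hφ hU hseg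
  refine ⟨_, isTwistedLoop_minus (fun l hl => mul_mem_SO3
    (transpose_mem_SO3 (hU.mem_SO3 _ (hseg _ left_mem_uIcc) l hl))
    (hU.mem_SO3 _ (hseg _ right_mem_uIcc) l hl)) ht hs, fun k hk => ?_, ?_⟩
  · simp [extendCoeff, hk]
  · simp [extendCoeff, h0]

lemma horizontal_mem_LoopPlusStar (hD : IsOpen D) (hφ : ContDiffOn ℝ ∞ φ D)
    (hU : IsExtendedFrame D φ U) {x x' y : ℝ} (hseg : ∀ t ∈ uIcc x x', (t, y) ∈ D) :
    (fun l => (U (x, y) l).transpose * (U (x', y) l * rot (φ (x, y) - φ (x', y)))) ∈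
      LoopPlusStar := by
  obtain ⟨a, h0, ht, hs⟩ := exists_coeff_horizontal hD hφ hU hseg
  refine ⟨_, isTwistedLoop_plus (fun l hl => mul_mem_SO3
    (transpose_mem_SO3 (hU.mem_SO3 _ (hseg _ left_mem_uIcc) l hl)) (mul_mem_SO3
    (hU.mem_SO3 _ (hseg _ right_mem_uIcc) l hl) (rot_mem_SO3 _))) ht hs, fun k hk => ?_, ?_⟩
  · simp [extendCoeff, hk]
  · simp [extendCoeff, h0]

lemma horizontal_mem_LoopPlus (hD : IsOpen D) (hφ : ContDiffOn ℝ ∞ φ D)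
    (hU : IsExtendedFrame D φ U) {x x' y : ℝ} (hseg : ∀ t ∈ uIcc x x', (t, y) ∈ D) :
    (fun l => (U (x, y) l).transpose * U (x', y) l) ∈ LoopPlus := by
  have h := mul_rot_mem_LoopPlus (horizontal_mem_LoopPlusStar hD hφ hU hseg)
    (φ (x', y) - φ (x, y))
  simpa only [mul_assoc, rot_mul_rot_of_add_eq_zero (r := φ (x, y) - φ (x', y))
    (s := φ (x', y) - φ (x, y)) (by ring), mul_one] using h

lemma mul_transpose_mul (hU : IsExtendedFrame D φ U) {p : ℝ × ℝ} (hp : p ∈ D) {l : ℝ}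
    (hl : 0 < l) (g : M3) : U p l * ((U p l).transpose * g) = g := by
  rw [← mul_assoc, mul_transpose_of_mem_SO3 (hU.mem_SO3 p hp l hl), one_mul]

/-- The explicit splitting `U = U₊ V₋` over `xReach D`. -/
lemma splitPlusMinus_of_mem_xReach (hD : IsOpen D) (hφ : ContDiffOn ℝ ∞ φ D)
    (hU : IsExtendedFrame D φ U) {x y : ℝ} (hp : (x, y) ∈ xReach D) :
    SplitPlusMinus (U (x, y)) (fun l => U (x, 0) l * rot (φ (0, 0) - φ (x, 0)))
      (fun l => rot (φ (x, 0) - φ (0, 0)) * ((U (x, 0) l).transpose * U (x, y) l)) := by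
  refine ⟨?_, rot_mul_mem_LoopMinus (vertical_mem_LoopMinusStar hφ hU hp.2) _, fun l hl => ?_⟩
  · obtain ⟨a, ⟨h1, h2, h3⟩, h4⟩ := horizontal_mem_LoopPlusStar hD hφ hU hp.1
    have he : ∀ l : ℝ, 0 < l → (U (0, 0) l).transpose *
        (U (x, 0) l * rot (φ (0, 0) - φ (x, 0))) = U (x, 0) l * rot (φ (0, 0) - φ (x, 0)) :=
      fun l hl => by rw [hU.initial l hl, Matrix.transpose_one, one_mul]
    exact ⟨a, ⟨fun l hl => he l hl ▸ h1 l hl, fun l hl => he l hl ▸ h2 l hl, h3⟩, h4⟩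
  · rw [mul_assoc, ← mul_assoc (rot _), rot_mul_rot_of_add_eq_zero (by ring), one_mul,
      mul_transpose_mul hU (hp.2 0 left_mem_uIcc) hl]

/-- The explicit splitting `U = U₋ V₊` over `yReach D`. -/
lemma splitMinusPlus_of_mem_yReach (hD : IsOpen D) (hφ : ContDiffOn ℝ ∞ φ D)
    (hU : IsExtendedFrame D φ U) {x y : ℝ} (hp : (x, y) ∈ yReach D) :
    SplitMinusPlus (U (x, y)) (U (0, y)) (fun l => (U (0, y) l).transpose * U (x, y) l) := by
  refine ⟨?_, horizontal_mem_LoopPlus hD hφ hU hp.2, fun l hl => ?_⟩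
  · obtain ⟨a, ⟨h1, h2, h3⟩, h4⟩ := vertical_mem_LoopMinusStar hφ hU hp.1
    have he : ∀ l : ℝ, 0 < l → (U (0, 0) l).transpose * U (0, y) l = U (0, y) l :=
      fun l hl => by rw [hU.initial l hl, Matrix.transpose_one, one_mul]
    exact ⟨a, ⟨fun l hl => he l hl ▸ h1 l hl, fun l hl => he l hl ▸ h2 l hl, h3⟩, h4⟩
  · rw [mul_transpose_mul hU (hp.2 0 left_mem_uIcc) hl]

lemma eventually_mem_xReach (hD : IsOpen D) {x y : ℝ} (hp : (x, y) ∈ xReach D) :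
    ∀ᶠ t in 𝓝 x, (t, y) ∈ xReach D := by
  have h1 : ∀ᶠ t in 𝓝 x, ∀ s ∈ uIcc x t, (s, (0 : ℝ)) ∈ D := by
    have hO : {s : ℝ | (s, (0 : ℝ)) ∈ D} ∈ 𝓝 x :=
      (hD.preimage (by fun_prop : Continuous fun s : ℝ => (s, (0 : ℝ)))).mem_nhds
        (hp.1 x right_mem_uIcc)
    obtain ⟨ε, hε, hb⟩ := Metric.mem_nhds_iff.1 hO
    filter_upwards [Metric.ball_mem_nhds x hε] with t ht s hs
    refine hb (mem_ball_iff_norm.2 (lt_of_le_of_lt ?_ (mem_ball_iff_norm.1 ht)))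
    exact abs_sub_left_of_mem_uIcc hs
  have h2 : ∀ᶠ t in 𝓝 x, ∀ s ∈ uIcc 0 y, (t, s) ∈ D :=
    isCompact_uIcc.eventually_forall_of_forall_eventually fun s hs => hD.mem_nhds (hp.2 s hs)
  filter_upwards [h1, h2] with t ht1 ht2
  refine ⟨fun s hs => ?_, ht2⟩
  rcases uIcc_subset_uIcc_union_uIcc (b := x) hs with h | h
  · exact hp.1 s h
  · exact ht1 s h

lemma eventually_mem_yReach (hD : IsOpen D) {x y : ℝ} (hp : (x, y) ∈ yReach D) :
    ∀ᶠ t in 𝓝 y, (x, t) ∈ yReach D :=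
  eventually_mem_xReach (D := Prod.swap ⁻¹' D) (hD.preimage continuous_swap) (x := y) (y := x) hp

end Frame

end Pseudospherical

open Pseudospherical in
theorem theorem6p2p1 (D : Set (ℝ × ℝ)) (hD : IsOpen D) (hD0 : ((0, 0) : ℝ × ℝ) ∈ D)
    (ψ N : ℝ × ℝ → E3) (φ : ℝ × ℝ → ℝ) (hψ : IsChebyshevSurface D ψ N φ)
    (U Up Um Vp Vm : ℝ × ℝ → ℝ → M3) (hU : IsExtendedFrame D φ U)
    (hpm : ∀ p ∈ D \ singularTwo D U, SplitPlusMinus (U p) (Up p) (Vm p))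
    (hmp : ∀ p ∈ D \ singularOne D U, SplitMinusPlus (U p) (Um p) (Vp p)) :
    -- `U₊` does not depend on `y`, and `U₋` does not depend on `x`
    (∀ x y y' : ℝ, (∀ t ∈ Set.uIcc y y', (x, t) ∈ D) →
      (x, y) ∉ singularTwo D U → (x, y') ∉ singularTwo D U →
      ∀ l : ℝ, 0 < l → Up (x, y) l = Up (x, y') l) ∧
    (∀ x x' y : ℝ, (∀ t ∈ Set.uIcc x x', (t, y) ∈ D) →
      (x, y) ∉ singularOne D U → (x', y) ∉ singularOne D U →
      ∀ l : ℝ, 0 < l → Um (x, y) l = Um (x', y) l) ∧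
    ∃ V₀ W₀ : ℝ → M3,
      (∀ x, V₀ x ∈ SO3) ∧ (∀ y, W₀ y ∈ SO3) ∧
      -- the differential equation and the initial condition for `U₊`
      (∀ x y : ℝ, (x, y) ∈ xReach D \ singularTwo D U → ∀ l : ℝ, 0 < l →
        ∃ d : M3, HasDerivAt (fun t : ℝ => Up (t, y) l) d x ∧
          (Up (x, y) l)⁻¹ * d = -(l • (V₀ x * betaOne x * (V₀ x)⁻¹))) ∧
      (∀ y : ℝ, (0, y) ∈ xReach D \ singularTwo D U → ∀ l : ℝ, 0 < l → Up (0, y) l = 1) ∧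
      -- the differential equation and the initial condition for `U₋`
      (∀ x y : ℝ, (x, y) ∈ yReach D \ singularOne D U → ∀ l : ℝ, 0 < l →
        ∃ d : M3, HasDerivAt (fun t : ℝ => Um (x, t) l) d y ∧
          (Um (x, y) l)⁻¹ * d = -(l⁻¹ • (W₀ y * gammaOne φ y * (W₀ y)⁻¹))) ∧
      (∀ x : ℝ, (x, 0) ∈ yReach D \ singularOne D U → ∀ l : ℝ, 0 < l → Um (x, 0) l = 1) ∧
      -- `V₀(x)` and `W₀(y)` are the constant terms of `V₋` at `(x, 0)` and of `V₊` at `(0, y)`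
      (∀ x : ℝ, (x, 0) ∈ xReach D \ singularTwo D U →
        Filter.Tendsto (Vm (x, 0)) Filter.atTop (nhds (V₀ x))) ∧
      (∀ y : ℝ, (0, y) ∈ yReach D \ singularOne D U →
        Filter.Tendsto (Vp (0, y)) (nhdsWithin 0 (Set.Ioi 0)) (nhds (W₀ y))) := by
  have hφ := hψ.smooth_angle
  have hx2 : ∀ x y : ℝ, (x, y) ∈ xReach D → (x, y) ∈ D \ singularTwo D U := fun x y h =>
    ⟨h.2 y Set.right_mem_uIcc, fun hs => hs.2 ⟨_, _, splitPlusMinus_of_mem_xReach hD hφ hU h⟩⟩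
  have hy1 : ∀ x y : ℝ, (x, y) ∈ yReach D → (x, y) ∈ D \ singularOne D U := fun x y h =>
    ⟨h.2 x Set.right_mem_uIcc, fun hs => hs.2 ⟨_, _, splitMinusPlus_of_mem_yReach hD hφ hU h⟩⟩
  have hUp : ∀ x y : ℝ, (x, y) ∈ xReach D → ∀ l : ℝ, 0 < l →
      Up (x, y) l = U (x, 0) l * rot (φ (0, 0) - φ (x, 0)) ∧
      Vm (x, y) l = rot (φ (x, 0) - φ (0, 0)) * ((U (x, 0) l).transpose * U (x, y) l) := by
    intro x y h l hl
    have := (hpm _ (hx2 x y h)).unique (splitPlusMinus_of_mem_xReach hD hφ hU h)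
      one_mem_LoopMinus (fun l _ => (mul_one _).symm) hl
    rwa [mul_one] at this
  have hUm : ∀ x y : ℝ, (x, y) ∈ yReach D → ∀ l : ℝ, 0 < l →
      Um (x, y) l = U (0, y) l ∧ Vp (x, y) l = (U (0, y) l).transpose * U (x, y) l := by
    intro x y h l hl
    have := (hmp _ (hy1 x y h)).unique (splitMinusPlus_of_mem_yReach hD hφ hU h)
      one_mem_LoopPlus (fun l _ => (mul_one _).symm) hl
    rwa [mul_one] at this
  refine ⟨fun x y y' hseg hn hn' l hl => ?_, fun x x' y hseg hn hn' l hl => ?_,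
    fun x => rot (φ (x, 0) - φ (0, 0)), fun _ => 1, fun x => rot_mem_SO3 _, fun _ => one_mem_SO3,
    fun x y hp l hl => ?_, fun y hp l hl => ?_, fun x y hp l hl => ?_, fun x hp l hl => ?_,
    fun x hp => ?_, fun y hp => ?_⟩
  · have hm := hseg y Set.left_mem_uIcc
    obtain ⟨a, ha, hk, h0⟩ := vertical_mem_LoopMinusStar hφ hU hseg
    exact ((hpm _ ⟨hm, hn⟩).unique (hpm _ ⟨hseg y' Set.right_mem_uIcc, hn'⟩)
      ⟨a, ha, hk, h0 ▸ rot_zero ▸ rot_mem_rotK 0⟩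
      (fun l hl => (mul_transpose_mul hU hm hl _).symm) hl).1
  · have hm := hseg x Set.left_mem_uIcc
    exact ((hmp _ ⟨hm, hn⟩).unique (hmp _ ⟨hseg x' Set.right_mem_uIcc, hn'⟩)
      (horizontal_mem_LoopPlus hD hφ hU hseg)
      (fun l hl => (mul_transpose_mul hU hm hl _).symm) hl).1
  · have hx0 : (x, (0 : ℝ)) ∈ D := hp.1.2 0 Set.left_mem_uIcc
    refine ⟨_, hasDerivAt_matrix_congr_of_eventuallyEq
      (hasDerivAt_gauged_frame hD hφ hU hx0 hl (φ (0, 0))) ?_, ?_⟩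
    · filter_upwards [eventually_mem_xReach hD hp.1] with t ht
      exact (hUp t y ht l hl).1
    · have hS := mul_mem_SO3 (hU.mem_SO3 _ hx0 l hl) (rot_mem_SO3 (φ (0, 0) - φ (x, 0)))
      rw [(hUp x y hp.1 l hl).1, inv_eq_transpose_of_mem_SO3 hS, Matrix.mul_smul, ← mul_assoc,
        transpose_mul_of_mem_SO3 hS, one_mul, smul_neg,
        inv_eq_transpose_of_mem_SO3 (rot_mem_SO3 _), rot_transpose, neg_sub, betaOne]
  · rw [(hUp 0 y hp.1 l hl).1, hU.initial l hl, sub_self, rot_zero, one_mul]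
  · have h0y : ((0 : ℝ), y) ∈ D := hp.1.2 0 Set.left_mem_uIcc
    refine ⟨_, hasDerivAt_matrix_congr_of_eventuallyEq (hU.lax_y (0, y) h0y l hl) ?_, ?_⟩
    · filter_upwards [eventually_mem_yReach hD hp.1] with t ht
      exact (hUm x t ht l hl).1
    · have hS := hU.mem_SO3 _ h0y l hl
      rw [(hUm x y hp.1 l hl).1, inv_eq_transpose_of_mem_SO3 hS, ← mul_assoc,
        transpose_mul_of_mem_SO3 hS, laxB_eq, gammaOne]
      simp
  · rw [(hUm x 0 hp.1 l hl).1, hU.initial l hl]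
  · refine tendsto_const_nhds.congr' ?_
    filter_upwards [eventually_gt_atTop 0] with l hl
    rw [(hUp x 0 hp.1 l hl).2,
      transpose_mul_of_mem_SO3 (hU.mem_SO3 _ (hp.1.2 0 Set.left_mem_uIcc) l hl), mul_one]
  · refine tendsto_const_nhds.congr' ?_
    filter_upwards [self_mem_nhdsWithin] with l hl
    rw [(hUm 0 y hp.1 l hl).2,
      transpose_mul_of_mem_SO3 (hU.mem_SO3 _ (hp.1.2 0 Set.left_mem_uIcc) l hl)]
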